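/- Fix the following model. The input is a list $X=(x_0,\dots,x_{N-1})\in\{0,1\}^N$. A quantum network $A$ with $T$ queries acts on finitely many qubits with computational basis states $|j,b,z\rangle$, where the index register $j$ can hold all of $0,\dots,N-1$, $b$ is one bit, and $z$ is a string of work bits. It applies $U_TOU_{T-1}O\cdots OU_1OU_0$ to the all-zero state, where the $U_i$ are arbitrary unitaries not depending on $X$, and $O$ is the query gate $|j,b,z\rangle\mapsto|j,b\oplus x_j,z\rangle$ (the identity on basis states with $j\ge N$). Then all qubits are measured, and the output is a function of the observed basis state. A *search network* outputs an index $j$ or "none"; its error probability $\varepsilon$ is the maximum, over all $X$ that contain at least one 1, of the probability that the output is not an index $j$ with $x_j=1$ (no requirement is made on the all-zero list). A *decision network* outputs a bit; its error probability $\varepsilon$ is the maximum over all $X$ of the probability that the output differs from $x_0\vee\dots\vee x_{N-1}$. **Corollary.** Let $(A_N)_{N\in\mathbb{N}}$ be a family of search networks, or a family of decision networks, where $A_N$ works on lists of $N$ bits, makes $T(N)$ queries and has error probability $\varepsilon(N)$. If $T(N)\in O(\sqrt N)$ then $\varepsilon(N)$ is not $o(1)$; indeed there is a constant $\delta>0$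 such that $\varepsilon(N)\ge\delta$ for all sufficiently large $N$. In particular, $\varepsilon(N)>1/N$ for all sufficiently large $N$, so error $\le 1/N$ is not achievable with $O(\sqrt N)$ queries. -/

import Mathlib

open Filter Asymptotics

namespace QuantumSearch

/-- Computational basis states `|j, b, z⟩` of a network with `l` index qubits, one target qubit and
`w` work qubits. The `l` index qubits are read as a number `j < 2 ^ l`. -/
abbrev BasisState (l w : ℕ) : Type := Fin (2 ^ l) × Bool × (Fin w → Bool)

/-- The basis state all of whose qubits are zero. -/
def zeroState (l w : ℕ) : BasisState l w :=
  (⟨0, Nat.two_pow_pos l⟩, false, fun _ => false)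

/-- Action of a query to the list `X` on basis states: `|j, b, z⟩ ↦ |j, b ⊕ x_j, z⟩`. The values
`j ≥ N` of the index register, which name no item, are left alone. -/
def queryMap {N : ℕ} (l w : ℕ) (X : Fin N → Bool) (s : BasisState l w) : BasisState l w :=
  if h : s.1.val < N then (s.1, xor s.2.1 (X ⟨s.1.val, h⟩), s.2.2) else s

/-- The query gate `O`, as a (permutation) matrix: its column at `|t⟩` is `|queryMap X t⟩`. -/
def queryGate {N : ℕ} (l w : ℕ) (X : Fin N → Bool) :
    Matrix (BasisState l w) (BasisState l w) ℂ :=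
  Matrix.of fun s t => if s = queryMap l w X t then 1 else 0

/-- A quantum network with access to a list of `N` bits and outputs in `α`:
`U_T O U_{T-1} O ⋯ O U_1 O U_0` applied to the all-zero state, where `T = queries` and the `U_i` are
arbitrary unitaries independent of the list, followed by a measurement of all qubits in the
computational basis. The output is a function `readout` of the observed basis state.
Of the sequence `U`, only `U 0, …, U T` are used. -/
structure QueryNetwork (N : ℕ) (α : Type) where
  /-- number of index qubits -/
  indexQubits : ℕ
  /-- the index register is large enough to address all items -/
  card_le : N ≤ 2 ^ indexQubits
  /-- number of work qubits -/
  workQubits : ℕ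
  /-- number of queries -/
  queries : ℕ
  /-- the unitaries applied between the queries -/
  U : ℕ → Matrix.unitaryGroup (BasisState indexQubits workQubits) ℂ
  /-- the output, given the observed basis state -/
  readout : BasisState indexQubits workQubits → α

namespace QueryNetwork

variable {N : ℕ} {α : Type}

/-- The vector of amplitudes `U_k O U_{k-1} O ⋯ O U_0 |0⟩`, on the list `X`. -/
noncomputable def stateAfter (A : QueryNetwork N α) (X : Fin N → Bool) :
    ℕ → (BasisState A.indexQubits A.workQubits → ℂ)
  | 0 => (A.U 0).1.mulVec (Pi.single (zeroState A.indexQubits A.workQubits) 1)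
  | k + 1 => (A.U (k + 1)).1.mulVec
      ((queryGate A.indexQubits A.workQubits X).mulVec (stateAfter A X k))

/-- The final state of the network on the list `X`. -/
noncomputable def finalState (A : QueryNetwork N α) (X : Fin N → Bool) :
    BasisState A.indexQubits A.workQubits → ℂ :=
  A.stateAfter X A.queries

open Classical in
/-- The probability that, on the list `X`, the output of the network lies in `S`. -/
noncomputable def outputProb (A : QueryNetwork N α) (X : Fin N → Bool) (S : Set α) : ℝ :=
  ∑ s with A.readout s ∈ S, ‖A.finalState X s‖ ^ 2

/-- The (worst-case) error probability: the maximum, over the finitely many lists `X`, of the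
probability of an output that is not correct for `X`. -/
noncomputable def errorProb (A : QueryNetwork N α) (correct : (Fin N → Bool) → α → Prop) : ℝ :=
  ⨆ X : Fin N → Bool, A.outputProb X {a | ¬ correct X a}

end QueryNetwork

/-- Correct answers in search: some `j` with `x_j = 1`, if there is one. The output `none` stands for
"no solution found". On the all-zero list every output counts as correct; this can only lower the
error probability. -/
def SearchCorrect {N : ℕ} (X : Fin N → Bool) (a : Option (Fin N)) : Prop :=
  (∃ j, X j = true) → ∃ j, a = some j ∧ X j = true

/-- Correct answers in the decision version of search: the OR of the bits of the list. -/
def OrCorrect {N : ℕ} (X : Fin N → Bool) (b : Bool) : Prop :=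
  b = true ↔ ∃ j, X j = true

end QuantumSearch

/-! This is the polynomial method. Each query raises the degree of the amplitudes in the bits by at
most one, so the probability `R` of reporting no correct index (search) or of answering 0 (decision)
has degree at most `d = 2T + 1`. It is at most `ε` on nonzero lists and at least `1 - ε` on the zero
list.

Averaging `R` over independent bits of bias `p` gives a univariate polynomial `Q` of degree at most
`d` with `Q(0) = R(0)`. For `p ≥ L/N` the zero list has weight at most `exp(-L)`, so `Q ≤ exp(-L) +
ε` on `[L/N, 1]`. Chebyshev's extremal bound (`eval_zero_le_of_abs_le`) then limits `Q(0)` to `exp(d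
√(8L/N))` times that. For `d = O(√N)` this factor is only `exp(O(√L))`, so a large constant `L`
makes `exp(-L)` negligible and forces `ε` to be bounded below. -/

namespace QuantumSearch

/-! ### Polynomials on the Boolean cube and Chebyshev growth -/

section LowDegree

open Polynomial

variable {ι : Type*}

/-- Real functions on the Boolean cube that are polynomials of degree at most `d` in the bits. -/
def lowDegree (ι : Type*) (d : ℕ) : Submodule ℝ ((ι → Bool) → ℝ) :=
  Submodule.span ℝ {f | ∃ S : Finset ι, S.card ≤ d ∧
    f = {X : ι → Bool | ∀ i ∈ S, X i = true}.indicator 1}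

lemma lowDegree_mono {d e : ℕ} (h : d ≤ e) : lowDegree ι d ≤ lowDegree ι e :=
  Submodule.span_mono fun _ ⟨S, hS, hf⟩ => ⟨S, hS.trans h, hf⟩

lemma const_mem_lowDegree (d : ℕ) (c : ℝ) : (fun _ => c) ∈ lowDegree ι d := by
  have h : (1 : (ι → Bool) → ℝ) ∈ lowDegree ι d :=
    Submodule.subset_span ⟨∅, by simp, by simp⟩
  convert (lowDegree ι d).smul_mem c h using 1
  ext; simp

lemma bit_mem_lowDegree (i : ι) : (fun X => if X i = true then 1 else 0) ∈ lowDegree ι 1 :=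
  Submodule.subset_span ⟨{i}, by simp, by ext X; simp [Set.indicator]⟩

/-- Bits are idempotent, so the monomials of `S` and `T` multiply to that of `S ∪ T`. -/
lemma mul_mem_lowDegree {d e : ℕ} {f g : (ι → Bool) → ℝ} (hf : f ∈ lowDegree ι d)
    (hg : g ∈ lowDegree ι e) : f * g ∈ lowDegree ι (d + e) := by
  classical
  have h : lowDegree ι d * lowDegree ι e ≤ lowDegree ι (d + e) := by
    rw [lowDegree, lowDegree, Submodule.span_mul_span]
    refine Submodule.span_mono ?_
    rintro _ ⟨_, ⟨S, hS, rfl⟩, _, ⟨T, hT, rfl⟩, rfl⟩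
    refine ⟨S ∪ T, (Finset.card_union_le S T).trans (add_le_add hS hT), ?_⟩
    have : {X : ι → Bool | ∀ i ∈ S ∪ T, X i = true}
        = {X | ∀ i ∈ S, X i = true} ∩ {X | ∀ i ∈ T, X i = true} := by
      ext X
      simp only [Finset.mem_union, Set.mem_ofPred_eq, Set.mem_inter_iff]
      grind
    rw [this, Set.inter_indicator_one]
  exact h (Submodule.mul_mem_mul hf hg)

variable [Fintype ι]

/-- The probability of the list `X` if the bits are independent and equal to 1 with
probability `p`. -/
def bernoulliWeight (p : ℝ) (X : ι → Bool) : ℝ := ∏ i, if X i = true then p else 1 - p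

lemma bernoulliWeight_nonneg {p : ℝ} (h0 : 0 ≤ p) (h1 : p ≤ 1) (X : ι → Bool) :
    0 ≤ bernoulliWeight p X :=
  Finset.prod_nonneg fun i _ => by split_ifs <;> linarith

variable [DecidableEq ι]

lemma sum_bernoulliWeight_mul_indicator (p : ℝ) (S : Finset ι) :
    ∑ X : ι → Bool, bernoulliWeight p X * {X : ι → Bool | ∀ i ∈ S, X i = true}.indicator 1 X
      = p ^ S.card := by
  have key : ∀ X : ι → Bool,
      bernoulliWeight p X * {X : ι → Bool | ∀ i ∈ S, X i = true}.indicator 1 X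
        = ∏ i, (if X i = true then p else if i ∈ S then 0 else 1 - p) := by
    intro X
    by_cases hX : ∀ i ∈ S, X i = true
    · rw [Set.indicator_of_mem (by exact hX), Pi.one_apply, mul_one]
      refine Finset.prod_congr rfl fun i _ => ?_
      grind
    · rw [Set.indicator_of_notMem (by exact hX), mul_zero, eq_comm]
      push Not at hX
      obtain ⟨i, hi, hXi⟩ := hX
      exact Finset.prod_eq_zero (Finset.mem_univ i) (by simp [hi, hXi])
  simp_rw [key]
  have h := Finset.prod_univ_sum (fun _ : ι => (Finset.univ : Finset Bool))
    (fun i b => if b = true then p else if i ∈ S then 0 else 1 - p)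
  rw [Fintype.piFinset_univ] at h
  rw [← h]
  have : ∀ i, (∑ b : Bool, if b = true then p else if i ∈ S then 0 else 1 - p)
      = if i ∈ S then p else 1 := by
    intro i
    by_cases hi : i ∈ S <;> simp [hi]
  simp_rw [this]
  simp

lemma sum_bernoulliWeight (p : ℝ) : ∑ X : ι → Bool, bernoulliWeight p X = 1 := by
  simpa using sum_bernoulliWeight_mul_indicator (ι := ι) p ∅

/-- By linearity it suffices to treat a monomial, whose expectation is `p ^ S.card` by independence.
-/
lemma exists_polynomial_expectation {d : ℕ} {f : (ι → Bool) → ℝ} (hf : f ∈ lowDegree ι d) :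
    ∃ Q : ℝ[X], Q.degree ≤ d ∧ ∀ p, Q.eval p = ∑ X, bernoulliWeight p X * f X := by
  induction hf using Submodule.span_induction with
  | mem f hf =>
    obtain ⟨S, hS, rfl⟩ := hf
    refine ⟨X ^ S.card, ?_, fun p => ?_⟩
    · rw [degree_X_pow]; exact_mod_cast hS
    · rw [sum_bernoulliWeight_mul_indicator]; simp
  | zero => exact ⟨0, by simp, by simp⟩
  | add f g _ _ hf hg =>
    obtain ⟨P, hP, hP'⟩ := hf
    obtain ⟨Q, hQ, hQ'⟩ := hg
    refine ⟨P + Q, (degree_add_le _ _).trans (max_le hP hQ), fun p => ?_⟩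
    simp [hP', hQ', mul_add, Finset.sum_add_distrib]
  | smul c f _ hf =>
    obtain ⟨P, hP, hP'⟩ := hf
    refine ⟨c • P, (degree_smul_le _ _).trans hP, fun p => ?_⟩
    simp only [eval_smul, hP', Pi.smul_apply, smul_eq_mul, Finset.mul_sum]
    exact Finset.sum_congr rfl fun _ _ => by ring

/-- Among polynomials bounded by 1 on `[-1, 1]`, the Chebyshev polynomial grows fastest outside, and
`T_d(cosh θ) = cosh(dθ) ≤ exp(dθ)`. -/
lemma eval_zero_le_of_abs_le {d : ℕ} {Q : ℝ[X]} (hQ : Q.degree ≤ d) {a M : ℝ} (ha : 0 ≤ a)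
    (ha' : a ≤ 1 / 4) (hM : 0 < M) (hb : ∀ p ∈ Set.Icc a 1, |Q.eval p| ≤ M) :
    Q.eval 0 ≤ M * Real.exp (d * √(8 * a)) := by
  -- Chosen so that `1 + θ² / 2`, a lower bound for `cosh θ`, equals `1 + 4a`.
  set θ := √(8 * a) with hθ
  have hθ2 : θ ^ 2 = 8 * a := Real.sq_sqrt (by positivity)
  have hlow : 1 + 4 * a ≤ Real.cosh θ := by
    have h1 := Real.cosh_two_mul (θ / 2)
    have h2 : θ / 2 ≤ Real.sinh (θ / 2) := Real.self_le_sinh_iff.2 (by positivity)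
    rw [Real.cosh_sq, mul_div_cancel₀ θ two_ne_zero] at h1
    have h3 : 0 ≤ θ / 2 := by positivity
    nlinarith
  have hup : Real.cosh θ ≤ 3 := by
    refine (Real.cosh_le_exp_half_sq θ).trans ?_
    refine (Real.exp_le_exp.2 (show θ ^ 2 / 2 ≤ 1 by linarith)).trans ?_
    linarith [Real.exp_one_lt_d9]
  -- The substitution sends `cosh θ` to 0 and `[-1, 1]` to `[(cosh θ - 1)/4, (cosh θ + 1)/4]`, which
  -- lies in `[a, 1]` by `hlow` and `hup`.
  let P : ℝ[X] := C M⁻¹ * Q.comp (C (1 / 4 * Real.cosh θ) - C (1 / 4) * X)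
  have hP : ∀ u, P.eval u = M⁻¹ * Q.eval (1 / 4 * Real.cosh θ - 1 / 4 * u) := by
    intro u; simp [P]
  have hdeg : P.degree ≤ d := by
    refine (degree_le_natDegree).trans ?_
    have h1 : (C (1 / 4 * Real.cosh θ) - C (1 / 4) * X : ℝ[X]).natDegree ≤ 1 := by compute_degree
    have h2 : Q.natDegree ≤ d := natDegree_le_of_degree_le hQ
    have : P.natDegree ≤ d := by
      refine (natDegree_C_mul_le _ _).trans (natDegree_comp_le.trans ?_)
      nlinarith
    exact_mod_cast this
  have h := Polynomial.Chebyshev.eval_iterate_derivative_le_of_forall_abs_le_one (k := 0)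
    (Real.one_le_cosh θ) hdeg (fun u hu => by
      rw [hP, abs_mul, abs_of_pos (inv_pos.2 hM), inv_mul_le_iff₀ hM, mul_one]
      exact hb _ ⟨by linarith [hu.2], by linarith [hu.1]⟩)
  simp only [Function.iterate_zero, id_eq, hP, sub_self, Polynomial.Chebyshev.T_real_cosh] at h
  rw [inv_mul_le_iff₀ hM] at h
  refine h.trans (mul_le_mul_of_nonneg_left ?_ hM.le)
  have hn : 0 ≤ (d : ℝ) * θ := by positivity
  rw [Int.cast_natCast, Real.cosh_eq]
  have := Real.exp_le_exp.2 (show -(d * θ) ≤ d * θ by linarith)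
  linarith

/-- A nonnegative polynomial of degree `d` in `N` bits that is at most `ε` on the nonzero lists
cannot be large at the zero list. -/
lemma value_at_zero_le {N d : ℕ} (hN : 0 < N) {R : (Fin N → Bool) → ℝ}
    (hR : R ∈ lowDegree (Fin N) d) (h0 : ∀ X, 0 ≤ R X) (h1 : R (fun _ => false) ≤ 1) {ε : ℝ}
    (hε : 0 ≤ ε) (h : ∀ X, (∃ j, X j = true) → R X ≤ ε) {A : ℝ} (hA : 0 ≤ A) (hAN : 4 * A ≤ N) :
    R (fun _ => false) ≤ (Real.exp (-A) + ε) * Real.exp (d * √(8 * (A / N))) := by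
  obtain ⟨Q, hQ, hQe⟩ := exists_polynomial_expectation hR
  have hN' : (0 : ℝ) < N := by exact_mod_cast hN
  have hle : ∀ X, R X ≤ ({fun _ => false} : Set (Fin N → Bool)).indicator 1 X + ε := by
    intro X
    by_cases hX : X = fun _ => false
    · subst hX; simp; linarith
    · rw [Set.indicator_of_notMem (by simpa using hX), zero_add]
      refine h X ?_
      by_contra hc
      push Not at hc
      exact hX (funext fun j => by simpa using hc j)
  -- At `p = 0` all the weight sits on the zero list.
  have hzero : Q.eval 0 = R (fun _ => false) := by
    rw [hQe, Finset.sum_eq_single (fun _ => false)]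
    · simp [bernoulliWeight]
    · intro X _ hX
      obtain ⟨j, hj⟩ := Function.ne_iff.1 hX
      rw [bernoulliWeight, Finset.prod_eq_zero (Finset.mem_univ j) (by simp_all), zero_mul]
    · simp
  rw [← hzero]
  refine eval_zero_le_of_abs_le hQ (by positivity) ?_ (by positivity) fun p hp => ?_
  · rw [div_le_iff₀ hN']; linarith
  have hp0 : 0 ≤ p := le_trans (by positivity) hp.1
  rw [hQe, abs_of_nonneg (Finset.sum_nonneg fun X _ =>
    mul_nonneg (bernoulliWeight_nonneg hp0 hp.2 X) (h0 X))]
  calc ∑ X, bernoulliWeight p X * R X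
      ≤ ∑ X, bernoulliWeight p X *
          (({fun _ => false} : Set (Fin N → Bool)).indicator 1 X + ε) :=
        Finset.sum_le_sum fun X _ =>
          mul_le_mul_of_nonneg_left (hle X) (bernoulliWeight_nonneg hp0 hp.2 X)
    _ = (1 - p) ^ N + ε := by
        simp_rw [mul_add, Finset.sum_add_distrib, ← Finset.sum_mul, sum_bernoulliWeight, one_mul]
        rw [Finset.sum_eq_single (fun _ => false)]
        · simp [bernoulliWeight]
        · intro X _ hX
          simp [hX]
        · simp
    _ ≤ Real.exp (-A) + ε := by
        gcongr
        calc (1 - p) ^ N ≤ (Real.exp (-p)) ^ N :=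
              pow_le_pow_left₀ (by linarith [hp.2]) (Real.one_sub_le_exp_neg p) N
          _ = Real.exp (-(N * p)) := by rw [← Real.exp_nat_mul]; ring_nf
          _ ≤ Real.exp (-A) := by
              have := (div_le_iff₀ hN').1 hp.1
              exact Real.exp_le_exp.2 (by linarith)

end LowDegree

end QuantumSearch

namespace QuantumSearch

/-! ### Effect of queries and unitaries on degree and norm -/

section Amplitudes

variable {N : ℕ}

/-- Complex functions of the list whose real and imaginary parts are polynomials of degree at most
`d` in the bits. -/
def HasLowDegree (d : ℕ) (f : (Fin N → Bool) → ℂ) : Prop :=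
  (fun X => (f X).re) ∈ lowDegree (Fin N) d ∧ (fun X => (f X).im) ∈ lowDegree (Fin N) d

namespace HasLowDegree

variable {d : ℕ} {f g : (Fin N → Bool) → ℂ}

lemma const (d : ℕ) (c : ℂ) : HasLowDegree (N := N) d fun _ => c :=
  ⟨const_mem_lowDegree d c.re, const_mem_lowDegree d c.im⟩

lemma add (hf : HasLowDegree d f) (hg : HasLowDegree d g) :
    HasLowDegree d fun X => f X + g X :=
  ⟨Submodule.add_mem _ hf.1 hg.1, Submodule.add_mem _ hf.2 hg.2⟩

lemma const_mul (c : ℂ) (hf : HasLowDegree d f) : HasLowDegree d fun X => c * f X := by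
  refine ⟨?_, ?_⟩
  · simp only [Complex.mul_re]
    exact Submodule.sub_mem _ (Submodule.smul_mem _ c.re hf.1) (Submodule.smul_mem _ c.im hf.2)
  · simp only [Complex.mul_im]
    exact Submodule.add_mem _ (Submodule.smul_mem _ c.re hf.2) (Submodule.smul_mem _ c.im hf.1)

lemma sum {ι : Type*} (s : Finset ι) {F : ι → (Fin N → Bool) → ℂ}
    (hF : ∀ i ∈ s, HasLowDegree d (F i)) : HasLowDegree d fun X => ∑ i ∈ s, F i X := by
  classical
  induction s using Finset.induction_on with
  | empty => simpa using const d 0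
  | insert i s hi ih =>
    simp only [Finset.sum_insert hi]
    exact (hF i (by simp)).add (ih fun j hj => hF j (by simp [hj]))

lemma mono {e : ℕ} (h : d ≤ e) (hf : HasLowDegree d f) : HasLowDegree e f :=
  ⟨lowDegree_mono h hf.1, lowDegree_mono h hf.2⟩

lemma bit_mul (j : Fin N) (hf : HasLowDegree d f) :
    HasLowDegree (d + 1) fun X => if X j = true then f X else 0 := by
  refine ⟨?_, ?_⟩
  · convert mul_mem_lowDegree hf.1 (bit_mem_lowDegree j) using 1
    ext X
    by_cases h : X j = true <;> simp [h]
  · convert mul_mem_lowDegree hf.2 (bit_mem_lowDegree j) using 1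
    ext X
    by_cases h : X j = true <;> simp [h]

lemma norm_sq_mem (hf : HasLowDegree d f) :
    (fun X => ‖f X‖ ^ 2) ∈ lowDegree (Fin N) (2 * d) := by
  have h := Submodule.add_mem _ (mul_mem_lowDegree hf.1 hf.1) (mul_mem_lowDegree hf.2 hf.2)
  rw [← two_mul] at h
  convert h using 1
  ext X
  simp [Complex.sq_norm, Complex.normSq_apply]

end HasLowDegree

lemma queryMap_queryMap (l w : ℕ) (X : Fin N → Bool) (s : BasisState l w) :
    queryMap l w X (queryMap l w X s) = s := by
  unfold queryMap
  by_cases h : s.1.val < N <;> simp [h]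

lemma queryGate_mulVec (l w : ℕ) (X : Fin N → Bool) (v : BasisState l w → ℂ)
    (s : BasisState l w) : (queryGate l w X).mulVec v s = v (queryMap l w X s) := by
  have h : ∀ t, (s = queryMap l w X t) ↔ (t = queryMap l w X s) := fun t =>
    ⟨fun h => by rw [h, queryMap_queryMap], fun h => by rw [h, queryMap_queryMap]⟩
  simp [Matrix.mulVec, dotProduct, queryGate, h]

/-- With `s'` denoting `s` with its target bit flipped, the new amplitude at `s` is `v s + x_j (v s'
- v s)`. -/
lemma hasLowDegree_query {l w d : ℕ} {v : (Fin N → Bool) → BasisState l w → ℂ}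
    (hv : ∀ s, HasLowDegree d fun X => v X s) (s : BasisState l w) :
    HasLowDegree (d + 1) fun X => (queryGate l w X).mulVec (v X) s := by
  simp only [queryGate_mulVec]
  by_cases h : s.1.val < N
  · convert ((hv s).mono (Nat.le_succ d)).add
      (((hv (s.1, !s.2.1, s.2.2)).add ((hv s).const_mul (-1))).bit_mul ⟨s.1.val, h⟩) using 2 with X
    by_cases hX : X ⟨s.1.val, h⟩ = true <;> simp [queryMap, h, hX]
  · simpa [queryMap, h] using (hv s).mono (Nat.le_succ d)

lemma hasLowDegree_mulVec {m : Type*} [Fintype m] {d : ℕ} (M : Matrix m m ℂ)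
    {v : (Fin N → Bool) → m → ℂ} (hv : ∀ s, HasLowDegree d fun X => v X s) (s : m) :
    HasLowDegree d fun X => M.mulVec (v X) s :=
  HasLowDegree.sum _ fun t _ => (hv t).const_mul (M s t)

lemma sum_norm_sq_unitary_mulVec {m : Type*} [Fintype m] [DecidableEq m]
    (U : Matrix.unitaryGroup m ℂ) (v : m → ℂ) :
    ∑ s, ‖U.1.mulVec v s‖ ^ 2 = ∑ s, ‖v s‖ ^ 2 := by
  have key : ∀ u : m → ℂ, ((∑ s, ‖u s‖ ^ 2 : ℝ) : ℂ) = star u ⬝ᵥ u := by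
    intro u
    simp [dotProduct, Complex.conj_mul']
  have h : star (U.1.mulVec v) ⬝ᵥ U.1.mulVec v = star v ⬝ᵥ v := by
    rw [Matrix.star_mulVec, Matrix.dotProduct_mulVec, Matrix.vecMul_vecMul,
      ← Matrix.star_eq_conjTranspose, Matrix.mem_unitaryGroup_iff'.1 U.2, Matrix.vecMul_one]
  rw [← key, ← key] at h
  exact_mod_cast h

lemma sum_norm_sq_queryGate_mulVec (l w : ℕ) (X : Fin N → Bool) (v : BasisState l w → ℂ) :
    ∑ s, ‖(queryGate l w X).mulVec v s‖ ^ 2 = ∑ s, ‖v s‖ ^ 2 := by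
  simp only [queryGate_mulVec]
  exact Equiv.sum_comp (Function.Involutive.toPerm _ (queryMap_queryMap l w X))
    fun s => ‖v s‖ ^ 2

end Amplitudes

/-! ### Output probabilities and the tradeoff between error and queries -/

namespace QueryNetwork

variable {N : ℕ} {α : Type} (A : QueryNetwork N α)

lemma hasLowDegree_stateAfter (k : ℕ) (s : BasisState A.indexQubits A.workQubits) :
    HasLowDegree k fun X => A.stateAfter X k s := by
  induction k generalizing s with
  | zero => exact HasLowDegree.const 0 _
  | succ k ih => exact hasLowDegree_mulVec _ (hasLowDegree_query ih) s

lemma sum_norm_sq_stateAfter (X : Fin N → Bool) (k : ℕ) :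
    ∑ s, ‖A.stateAfter X k s‖ ^ 2 = 1 := by
  induction k with
  | zero =>
    rw [stateAfter, sum_norm_sq_unitary_mulVec, Finset.sum_eq_single (zeroState _ _)]
    · simp
    · intro s _ hs
      simp [hs]
    · simp
  | succ k ih => rw [stateAfter, sum_norm_sq_unitary_mulVec, sum_norm_sq_queryGate_mulVec, ih]

lemma outputProb_nonneg (X : Fin N → Bool) (S : Set α) : 0 ≤ A.outputProb X S :=
  Finset.sum_nonneg fun _ _ => by positivity

lemma outputProb_add_compl (X : Fin N → Bool) (S : Set α) :
    A.outputProb X S + A.outputProb X Sᶜ = 1 := by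
  rw [← A.sum_norm_sq_stateAfter X A.queries, outputProb, outputProb, Finset.sum_filter,
    Finset.sum_filter, ← Finset.sum_add_distrib]
  refine Finset.sum_congr rfl fun s _ => ?_
  by_cases hs : A.readout s ∈ S <;> simp [hs, finalState]

lemma outputProb_univ (X : Fin N → Bool) : A.outputProb X Set.univ = 1 := by
  simpa [outputProb, finalState] using A.sum_norm_sq_stateAfter X A.queries

lemma outputProb_le_errorProb (correct : (Fin N → Bool) → α → Prop) (X : Fin N → Bool) :
    A.outputProb X {a | ¬ correct X a} ≤ A.errorProb correct :=
  le_ciSup (f := fun X => A.outputProb X {a | ¬ correct X a}) (Set.finite_range _).bddAbove X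

lemma errorProb_nonneg (correct : (Fin N → Bool) → α → Prop) : 0 ≤ A.errorProb correct :=
  (A.outputProb_nonneg _ _).trans (A.outputProb_le_errorProb correct fun _ => false)

/-- The tradeoff between the error probability and the number of queries of a decision network. -/
lemma one_sub_errorProb_le_decision (A : QueryNetwork N Bool) (hN : 0 < N) {L : ℝ} (hL : 0 ≤ L)
    (hLN : 4 * L ≤ N) :
    1 - A.errorProb OrCorrect ≤ (Real.exp (-L) + A.errorProb OrCorrect) *
      Real.exp ((2 * A.queries + 1 : ℕ) * √(8 * (L / N))) := by
  -- Degree `2T` would do here; the extra 1 matches the bound for search.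
  have hdeg : (fun X => A.outputProb X {false}) ∈ lowDegree (Fin N) (2 * A.queries + 1) := by
    have : (fun X => A.outputProb X {false})
        = ∑ s with A.readout s = false, fun X => ‖A.stateAfter X A.queries s‖ ^ 2 := by
      ext X
      simp only [outputProb, finalState, Finset.sum_apply, Set.mem_singleton_iff]
    rw [this]
    exact Submodule.sum_mem _ fun s _ =>
      lowDegree_mono (Nat.le_succ _) (A.hasLowDegree_stateAfter A.queries s).norm_sq_mem
  have hzero := A.outputProb_add_compl (fun _ => false) {false}
  have herr := A.outputProb_le_errorProb OrCorrect (fun _ => false)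
  have hset : {a : Bool | ¬ OrCorrect (N := N) (fun _ => false) a} = {false}ᶜ := by
    ext a; cases a <;> simp [OrCorrect]
  rw [hset] at herr
  refine le_trans (by linarith) (value_at_zero_le hN hdeg (fun X => A.outputProb_nonneg X _)
    (by linarith [A.outputProb_nonneg (fun _ => false) {false}ᶜ]) (A.errorProb_nonneg _)
    (fun X hX => ?_) hL hLN)
  have hset' : {a : Bool | ¬ OrCorrect X a} = {false} := by
    ext a; cases a <;> simp [OrCorrect, hX]
  have := A.outputProb_le_errorProb OrCorrect X
  rwa [hset'] at this

/-- The tradeoff between the error probability and the number of queries of a search network. -/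
lemma one_sub_errorProb_le_search (A : QueryNetwork N (Option (Fin N))) (hN : 0 < N) {L : ℝ}
    (hL : 0 ≤ L) (hLN : 4 * L ≤ N) :
    1 - A.errorProb SearchCorrect ≤ (Real.exp (-L) + A.errorProb SearchCorrect) *
      Real.exp ((2 * A.queries + 1 : ℕ) * √(8 * (L / N))) := by
  classical
  -- Unlike the error event, which is empty on the zero list, this event is certain there; on
  -- nonzero lists the two agree.
  let R : (Fin N → Bool) → ℝ := fun X => A.outputProb X {a | ¬ ∃ j, a = some j ∧ X j = true}
  have hdeg : R ∈ lowDegree (Fin N) (2 * A.queries + 1) := by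
    have : R = ∑ s, fun X => if ¬ ∃ j, A.readout s = some j ∧ X j = true then
        ‖A.stateAfter X A.queries s‖ ^ 2 else 0 := by
      ext X
      simp only [R, outputProb, finalState, Finset.sum_apply, Finset.sum_filter,
        Set.mem_ofPred_eq]
    rw [this]
    refine Submodule.sum_mem _ fun s _ => ?_
    have hs := (A.hasLowDegree_stateAfter A.queries s).norm_sq_mem
    cases hr : A.readout s with
    | none => simpa using lowDegree_mono (Nat.le_succ _) hs
    | some j =>
      -- Output `j` is wrong exactly when `x_j = 0`; the factor `1 - x_j` costs one more degree.
      refine (congrArg (· ∈ lowDegree (Fin N) (2 * A.queries + 1)) ?_).mpr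
        (Submodule.sub_mem _ (lowDegree_mono (Nat.le_succ _) hs)
          (mul_mem_lowDegree hs (bit_mem_lowDegree j)))
      ext X
      by_cases hX : X j = true <;> simp [hX]
  have hzero : R (fun _ => false) = 1 := by
    simpa [R] using A.outputProb_univ fun _ => false
  refine le_trans (by linarith [A.errorProb_nonneg SearchCorrect])
    (value_at_zero_le hN hdeg (fun X => A.outputProb_nonneg X _) hzero.le
      (A.errorProb_nonneg _) (fun X hX => ?_) hL hLN)
  have := A.outputProb_le_errorProb SearchCorrect X
  simpa [R, SearchCorrect, hX] using this

end QueryNetwork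

/-! ### Choice of constants and asymptotics -/

/-- If the error probability obeys the degree tradeoff and the number of queries is `O(√N)`, the
error probability is bounded away from zero. -/
lemma exists_errorProb_lower_bound {T : ℕ → ℕ} {ε : ℕ → ℝ}
    (hT : (fun N : ℕ => (T N : ℝ)) =O[atTop] fun N : ℕ => √(N : ℝ)) (hε : ∀ N, 0 ≤ ε N)
    (h : ∀ N : ℕ, 0 < N → ∀ L : ℝ, 0 ≤ L → 4 * L ≤ N →
      1 - ε N ≤ (Real.exp (-L) + ε N) * Real.exp ((2 * T N + 1 : ℕ) * √(8 * (L / N)))) :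
    ∃ δ : ℝ, 0 < δ ∧ ∀ᶠ N : ℕ in atTop, δ ≤ ε N := by
  obtain ⟨c, hc, hTc⟩ := hT.exists_pos
  -- Since `√N ≥ 1`, the bound `T ≤ c √N` gives `2T + 1 ≤ K √N`.
  set K : ℝ := 2 * c + 1 with hK
  have hK1 : 1 ≤ K := by linarith
  set G : ℝ := Real.exp (16 * K ^ 2) with hG
  have hG0 : 0 < G := Real.exp_pos _
  -- Solves `1 - ε ≤ 1/2 + ε G` for `ε`.
  refine ⟨1 / (2 * (1 + G)), by positivity, ?_⟩
  filter_upwards [hTc.bound, eventually_ge_atTop 1, eventually_ge_atTop ⌈4 * (32 * K ^ 2)⌉₊]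
    with N hTN hN1 hNK
  have hNr : (1 : ℝ) ≤ N := by exact_mod_cast hN1
  have hN0 : (0 : ℝ) < √(N : ℝ) := Real.sqrt_pos.2 (by linarith)
  have hsq : 1 ≤ √(N : ℝ) := Real.one_le_sqrt.2 hNr
  rw [Real.norm_of_nonneg (by positivity), Real.norm_of_nonneg (by positivity)] at hTN
  -- With `L = 32K²` the growth exponent is at most `K √N · 16K / √N = 16K²`, half of `L`, so the
  -- decay `exp(-L)` wins.
  have hmain := h N hN1 (32 * K ^ 2) (by positivity) (Nat.ceil_le.1 hNK)
  have hroot : √(8 * (32 * K ^ 2 / N)) = 16 * K / √(N : ℝ) := by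
    rw [show 8 * (32 * K ^ 2 / (N : ℝ)) = (16 * K) ^ 2 / N by ring,
      Real.sqrt_div (by positivity), Real.sqrt_sq (by positivity)]
  have hexp : Real.exp ((2 * T N + 1 : ℕ) * √(8 * (32 * K ^ 2 / N))) ≤ G := by
    refine Real.exp_le_exp.2 ?_
    rw [hroot, mul_div_assoc', div_le_iff₀ hN0]
    push_cast
    have : 2 * (T N : ℝ) + 1 ≤ K * √(N : ℝ) := by rw [hK]; linarith
    calc (2 * (T N : ℝ) + 1) * (16 * K) ≤ K * √(N : ℝ) * (16 * K) := by gcongr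
      _ = 16 * K ^ 2 * √(N : ℝ) := by ring
  have hhalf : Real.exp (-(32 * K ^ 2)) * G ≤ 1 / 2 := by
    rw [hG, ← Real.exp_add]
    calc Real.exp (-(32 * K ^ 2) + 16 * K ^ 2) ≤ Real.exp (-1) :=
          Real.exp_le_exp.2 (by nlinarith)
      _ ≤ 1 / 2 := by linarith [Real.exp_neg_one_lt_d9]
  have hprod : 1 - ε N ≤ (Real.exp (-(32 * K ^ 2)) + ε N) * G :=
    hmain.trans (mul_le_mul_of_nonneg_left hexp (by have := hε N; positivity))
  rw [div_le_iff₀ (by positivity)]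
  nlinarith

lemma not_isLittleO_one_and_inv_lt {ε : ℕ → ℝ}
    (h : ∃ δ : ℝ, 0 < δ ∧ ∀ᶠ N : ℕ in atTop, δ ≤ ε N) :
    (¬ ε =o[atTop] (fun _ : ℕ => (1 : ℝ))) ∧ (∃ δ : ℝ, 0 < δ ∧ ∀ᶠ N : ℕ in atTop, δ ≤ ε N) ∧
      ∀ᶠ N : ℕ in atTop, 1 / (N : ℝ) < ε N := by
  refine ⟨fun ho => ?_, h, ?_⟩ <;> obtain ⟨δ, hδ, hb⟩ := h
  · have ht := (isLittleO_one_iff ℝ).1 ho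
    exact hδ.not_ge (ge_of_tendsto ht hb)
  · filter_upwards [hb, tendsto_one_div_atTop_nhds_zero_nat.eventually_lt_const hδ] with N h1 h2
    exact h2.trans_le h1

end QuantumSearch

theorem mainTheorem2 :
    -- networks that search for an item
    (∀ A : (N : ℕ) → QuantumSearch.QueryNetwork N (Option (Fin N)),
      (fun N : ℕ => ((A N).queries : ℝ)) =O[atTop] (fun N : ℕ => Real.sqrt (N : ℝ)) →
        (¬ (fun N : ℕ => (A N).errorProb QuantumSearch.SearchCorrect) =o[atTop]
            (fun _ : ℕ => (1 : ℝ))) ∧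
        (∃ δ : ℝ, 0 < δ ∧
          ∀ᶠ N : ℕ in atTop, δ ≤ (A N).errorProb QuantumSearch.SearchCorrect) ∧
        (∀ᶠ N : ℕ in atTop, 1 / (N : ℝ) < (A N).errorProb QuantumSearch.SearchCorrect)) ∧
    -- networks that only decide whether there is an item to be found
    (∀ A : (N : ℕ) → QuantumSearch.QueryNetwork N Bool,
      (fun N : ℕ => ((A N).queries : ℝ)) =O[atTop] (fun N : ℕ => Real.sqrt (N : ℝ)) →
        (¬ (fun N : ℕ => (A N).errorProb QuantumSearch.OrCorrect) =o[atTop]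
            (fun _ : ℕ => (1 : ℝ))) ∧
        (∃ δ : ℝ, 0 < δ ∧
          ∀ᶠ N : ℕ in atTop, δ ≤ (A N).errorProb QuantumSearch.OrCorrect) ∧
        (∀ᶠ N : ℕ in atTop, 1 / (N : ℝ) < (A N).errorProb QuantumSearch.OrCorrect)) :=
  ⟨fun A hA => QuantumSearch.not_isLittleO_one_and_inv_lt <|
      QuantumSearch.exists_errorProb_lower_bound hA (fun N => (A N).errorProb_nonneg _)
        fun N hN _ hL hLN => (A N).one_sub_errorProb_le_search hN hL hLN,
    fun A hA => QuantumSearch.not_isLittleO_one_and_inv_lt <|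
      QuantumSearch.exists_errorProb_lower_bound hA (fun N => (A N).errorProb_nonneg _)
        fun N hN _ hL hLN => (A N).one_sub_errorProb_le_decision hN hL hLN⟩
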